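/- All matrices are real, and $n_1,n_2,m,p,T$ are nonnegative integers. Consider the exosystem $x_1(t+1)=A_1x_1(t)$ with state $x_1(t)\in\mathbb{R}^{n_1}$, an endosystem $x_2(t+1)=A_2x_2(t)+B_2u(t)+A_3x_1(t)$ with state $x_2(t)\in\mathbb{R}^{n_2}$ and input $u(t)\in\mathbb{R}^m$, and the output $z(t)=D_1x_1(t)+D_2x_2(t)+Eu(t)\in\mathbb{R}^p$. The matrices $A_1,A_3,D_1,D_2,E$ are known; $A_2,B_2$ are unknown. A control law $u(t)=K_1x_1(t)+K_2x_2(t)$ is called a regulator for $(A_2,B_2)$ if in the controlled system $z(t)\to0$ as $t\to\infty$ for all initial states $x_1(0),x_2(0)$, and $A_2+B_2K_2$ is stable. A square matrix is called stable if all its complex eigenvalues satisfy $|\lambda|<1$, and anti-stable if all its complex eigenvalues satisfy $|\lambda|\ge1$. Let data matrices $U_-=[u(0)\ \cdots\ u(T-1)]$, $X_{1-}=[x_1(0)\ \cdots\ x_1(T-1)]$, $X_2=[x_2(0)\ \cdots\ x_2(T)]$ be given, and put $X_{2-}=[x_2(0)\ \cdots\ x_2(T-1)]$, $X_{2+}=[x_2(1)\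 \cdots\ x_2(T)]$. Let $\Sigma_{\mathcal D}$ be the set of all $(A_2,B_2)$ with $X_{2+}=A_2X_{2-}+A_3X_{1-}+B_2U_-$, and assume that some (true) endosystem $(A_{2s},B_{2s})$ belongs to $\Sigma_{\mathcal D}$. The data $(U_-,X_{1-},X_2)$ are called informative for regulator design if there exist $K_1,K_2$ such that $u=K_1x_1+K_2x_2$ is a regulator for every $(A_2,B_2)\in\Sigma_{\mathcal D}$. **Theorem.** Assume that $A_1$ is anti-stable. Then the data $(U_-,X_{1-},X_2)$ are informative for regulator design if and only if at least one of the following two conditions holds: 1. $X_{2-}$ has full row rank and has a right inverse $X_{2-}^\sharp$ such that $(X_{2+}-A_3X_{1-})X_{2-}^\sharp$ is stable and $D_2+EU_-X_{2-}^\sharp=0$; moreover, $\operatorname{im}D_1\subseteq\operatorname{im}E$. 2. $X_{2-}$ has full row rank and has a right inverse $X_{2-}^\sharp$ such that $(X_{2+}-A_3X_{1-})X_{2-}^\sharp$ is stable; moreover, there exists a solution $W\in\mathbb{R}^{T\times n_1}$ of the linear equations $$X_{2-}WA_1-(X_{2+}-A_3X_{1-})W=A_3,\qquad D_1+(D_2X_{2-}+EU_-)W=0.$$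 If condition 1 holds, then there exists $K_1$ with $D_1+EK_1=0$, and for every such $K_1$ and every $X_{2-}^\sharp$ as in condition 1, the gains $K_1$ and $K_2:=U_-X_{2-}^\sharp$ define a regulator for every $(A_2,B_2)\in\Sigma_{\mathcal D}$. If condition 2 holds, then for every $X_{2-}^\sharp$ and $W$ as in condition 2, the gains $K_1:=U_-(I-X_{2-}^\sharp X_{2-})W$ and $K_2:=U_-X_{2-}^\sharp$ define a regulator for every $(A_2,B_2)\in\Sigma_{\mathcal D}$. -/

import Mathlib

open Matrix Filter Topology

namespace RegulatorDesign

/-- A real square matrix is (Schur) stable if all its complex eigenvalues lie in the open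
unit disc. -/
def IsStable {n : ℕ} (A : Matrix (Fin n) (Fin n) ℝ) : Prop :=
  ∀ μ : ℂ, Module.End.HasEigenvalue (Matrix.toLin' (A.map (algebraMap ℝ ℂ))) μ → ‖μ‖ < 1

/-- A real square matrix is anti-stable if all its complex eigenvalues `μ` satisfy `1 ≤ |μ|`. -/
def IsAntiStable {n : ℕ} (A : Matrix (Fin n) (Fin n) ℝ) : Prop :=
  ∀ μ : ℂ, Module.End.HasEigenvalue (Matrix.toLin' (A.map (algebraMap ℝ ℂ))) μ → 1 ≤ ‖μ‖

/-- All columns of the data matrix `[x(0) x(1) ⋯ x(T)]` but the last: `[x(0) ⋯ x(T-1)]`. -/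
def pastCols {n T : ℕ} (X : Matrix (Fin n) (Fin (T + 1)) ℝ) : Matrix (Fin n) (Fin T) ℝ :=
  Matrix.of fun i t => X i t.castSucc

/-- All columns of the data matrix `[x(0) x(1) ⋯ x(T)]` but the first: `[x(1) ⋯ x(T)]`. -/
def futureCols {n T : ℕ} (X : Matrix (Fin n) (Fin (T + 1)) ℝ) : Matrix (Fin n) (Fin T) ℝ :=
  Matrix.of fun i t => X i t.succ

/-- The set of all endosystems `(A₂, B₂)` that are consistent with the data `(U₋, X₁₋, X₂)`:
`X₂₊ = A₂ X₂₋ + A₃ X₁₋ + B₂ U₋`. -/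
def consistentSystems {n₁ n₂ m T : ℕ} (A₃ : Matrix (Fin n₂) (Fin n₁) ℝ)
    (U : Matrix (Fin m) (Fin T) ℝ) (X₁ : Matrix (Fin n₁) (Fin T) ℝ)
    (X₂ : Matrix (Fin n₂) (Fin (T + 1)) ℝ) :
    Set (Matrix (Fin n₂) (Fin n₂) ℝ × Matrix (Fin n₂) (Fin m) ℝ) :=
  {S | futureCols X₂ = S.1 * pastCols X₂ + A₃ * X₁ + S.2 * U}

/-- The sequences `x₁, x₂, u` form a trajectory of the interconnection of the exosystem
`x₁(t+1) = A₁ x₁(t)`, the endosystem `x₂(t+1) = A₂ x₂(t) + B₂ u(t) + A₃ x₁(t)` and the state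
feedback controller `u(t) = K₁ x₁(t) + K₂ x₂(t)`. -/
structure IsControlledTrajectory {n₁ n₂ m : ℕ} (A₁ : Matrix (Fin n₁) (Fin n₁) ℝ)
    (A₂ : Matrix (Fin n₂) (Fin n₂) ℝ) (B₂ : Matrix (Fin n₂) (Fin m) ℝ)
    (A₃ : Matrix (Fin n₂) (Fin n₁) ℝ)
    (K₁ : Matrix (Fin m) (Fin n₁) ℝ) (K₂ : Matrix (Fin m) (Fin n₂) ℝ)
    (x₁ : ℕ → Fin n₁ → ℝ) (x₂ : ℕ → Fin n₂ → ℝ) (u : ℕ → Fin m → ℝ) : Prop where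
  exo : ∀ t, x₁ (t + 1) = A₁ *ᵥ x₁ t
  endo : ∀ t, x₂ (t + 1) = A₂ *ᵥ x₂ t + B₂ *ᵥ u t + A₃ *ᵥ x₁ t
  feedback : ∀ t, u t = K₁ *ᵥ x₁ t + K₂ *ᵥ x₂ t

/-- The controlled system is output regulated: `z(t) = D₁ x₁(t) + D₂ x₂(t) + E u(t)` tends to `0`
along every trajectory, that is, for all initial states `x₁(0)` and `x₂(0)`. -/
def IsOutputRegulated {n₁ n₂ m p : ℕ} (A₁ : Matrix (Fin n₁) (Fin n₁) ℝ)
    (A₂ : Matrix (Fin n₂) (Fin n₂) ℝ) (B₂ : Matrix (Fin n₂) (Fin m) ℝ)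
    (A₃ : Matrix (Fin n₂) (Fin n₁) ℝ)
    (D₁ : Matrix (Fin p) (Fin n₁) ℝ) (D₂ : Matrix (Fin p) (Fin n₂) ℝ)
    (E : Matrix (Fin p) (Fin m) ℝ)
    (K₁ : Matrix (Fin m) (Fin n₁) ℝ) (K₂ : Matrix (Fin m) (Fin n₂) ℝ) : Prop :=
  ∀ (x₁ : ℕ → Fin n₁ → ℝ) (x₂ : ℕ → Fin n₂ → ℝ) (u : ℕ → Fin m → ℝ),
    IsControlledTrajectory A₁ A₂ B₂ A₃ K₁ K₂ x₁ x₂ u →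
      Tendsto (fun t => D₁ *ᵥ x₁ t + D₂ *ᵥ x₂ t + E *ᵥ u t) atTop (𝓝 0)

/-- The control law `u = K₁ x₁ + K₂ x₂` is a regulator for the endosystem `(A₂, B₂)`: the
controlled system is output regulated and endo-stable. -/
def IsRegulator {n₁ n₂ m p : ℕ} (A₁ : Matrix (Fin n₁) (Fin n₁) ℝ)
    (A₂ : Matrix (Fin n₂) (Fin n₂) ℝ) (B₂ : Matrix (Fin n₂) (Fin m) ℝ)
    (A₃ : Matrix (Fin n₂) (Fin n₁) ℝ)
    (D₁ : Matrix (Fin p) (Fin n₁) ℝ) (D₂ : Matrix (Fin p) (Fin n₂) ℝ)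
    (E : Matrix (Fin p) (Fin m) ℝ)
    (K₁ : Matrix (Fin m) (Fin n₁) ℝ) (K₂ : Matrix (Fin m) (Fin n₂) ℝ) : Prop :=
  IsOutputRegulated A₁ A₂ B₂ A₃ D₁ D₂ E K₁ K₂ ∧ IsStable (A₂ + B₂ * K₂)

/-- The control law `u = K₁ x₁ + K₂ x₂` is a regulator for every endosystem that is consistent
with the data. -/
def IsRegulatorForData {n₁ n₂ m p T : ℕ} (A₁ : Matrix (Fin n₁) (Fin n₁) ℝ)
    (A₃ : Matrix (Fin n₂) (Fin n₁) ℝ)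
    (D₁ : Matrix (Fin p) (Fin n₁) ℝ) (D₂ : Matrix (Fin p) (Fin n₂) ℝ)
    (E : Matrix (Fin p) (Fin m) ℝ)
    (U : Matrix (Fin m) (Fin T) ℝ) (X₁ : Matrix (Fin n₁) (Fin T) ℝ)
    (X₂ : Matrix (Fin n₂) (Fin (T + 1)) ℝ)
    (K₁ : Matrix (Fin m) (Fin n₁) ℝ) (K₂ : Matrix (Fin m) (Fin n₂) ℝ) : Prop :=
  ∀ A₂ B₂, (A₂, B₂) ∈ consistentSystems A₃ U X₁ X₂ →
    IsRegulator A₁ A₂ B₂ A₃ D₁ D₂ E K₁ K₂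

/-- The data `(U₋, X₁₋, X₂)` are informative for regulator design: one single control law is a
regulator for every endosystem that is consistent with the data. -/
def IsInformativeForRegulatorDesign {n₁ n₂ m p T : ℕ} (A₁ : Matrix (Fin n₁) (Fin n₁) ℝ)
    (A₃ : Matrix (Fin n₂) (Fin n₁) ℝ)
    (D₁ : Matrix (Fin p) (Fin n₁) ℝ) (D₂ : Matrix (Fin p) (Fin n₂) ℝ)
    (E : Matrix (Fin p) (Fin m) ℝ)
    (U : Matrix (Fin m) (Fin T) ℝ) (X₁ : Matrix (Fin n₁) (Fin T) ℝ)
    (X₂ : Matrix (Fin n₂) (Fin (T + 1)) ℝ) : Prop :=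
  ∃ (K₁ : Matrix (Fin m) (Fin n₁) ℝ) (K₂ : Matrix (Fin m) (Fin n₂) ℝ),
    IsRegulatorForData A₁ A₃ D₁ D₂ E U X₁ X₂ K₁ K₂

/-- `R` is a right inverse of `X₂₋` such that `(X₂₊ - A₃ X₁₋) R` is stable. -/
def IsStabilizingRightInverse {n₁ n₂ T : ℕ} (A₃ : Matrix (Fin n₂) (Fin n₁) ℝ)
    (X₁ : Matrix (Fin n₁) (Fin T) ℝ) (X₂ : Matrix (Fin n₂) (Fin (T + 1)) ℝ)
    (R : Matrix (Fin T) (Fin n₂) ℝ) : Prop :=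
  pastCols X₂ * R = 1 ∧ IsStable ((futureCols X₂ - A₃ * X₁) * R)

/-- `W` solves the data-driven regulator equations
`X₂₋ W A₁ - (X₂₊ - A₃ X₁₋) W = A₃` and `D₁ + (D₂ X₂₋ + E U₋) W = 0`. -/
def SolvesRegulatorEquations {n₁ n₂ m p T : ℕ} (A₁ : Matrix (Fin n₁) (Fin n₁) ℝ)
    (A₃ : Matrix (Fin n₂) (Fin n₁) ℝ)
    (D₁ : Matrix (Fin p) (Fin n₁) ℝ) (D₂ : Matrix (Fin p) (Fin n₂) ℝ)
    (E : Matrix (Fin p) (Fin m) ℝ)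
    (U : Matrix (Fin m) (Fin T) ℝ) (X₁ : Matrix (Fin n₁) (Fin T) ℝ)
    (X₂ : Matrix (Fin n₂) (Fin (T + 1)) ℝ)
    (W : Matrix (Fin T) (Fin n₁) ℝ) : Prop :=
  pastCols X₂ * W * A₁ - (futureCols X₂ - A₃ * X₁) * W = A₃ ∧
    D₁ + (D₂ * pastCols X₂ + E * U) * W = 0

end RegulatorDesign

open RegulatorDesign

/-! Necessity is the substantial half. Adding to a consistent pair any `(A₀, B₀)` that annihilates
the data gives another consistent pair. Rank-one perturbations of this kind would make the trace of
the closed loop unbounded unless `K₂ = U * R` for a right inverse `R`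
(`exists_rightInverse_of_isStable`).

The closed loop `F` is then the same for all consistent pairs. As `A₁` is anti-stable and `F`
stable, the Sylvester equation has a solution `P`, and regulation forces zero output on the
invariant subspace `x₂ = P x₁`. With `L = D₂ + E * K₂`, either `L = 0`, which is condition 1, or
perturbations that leave `F` fixed put the columns of `K₁` in the image of `U * (1 - R * pastCols
X₂)` (`eq_zero_of_sylvester_annihilated`), which produces `W`.

Conversely, `W` encodes a state map `P = pastCols X₂ * W` and an input map `U * W` that solve the
regulator equations of every consistent system at once. -/

/-! ### Powers, spectra and solvability of linear equations -/

/-- The vectors with decaying orbit form an invariant subspace; if nonzero, it contains an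
eigenvector, whose orbit cannot shrink. -/
theorem Module.End.eq_zero_of_tendsto_pow {V : Type*} [NormedAddCommGroup V] [NormedSpace ℂ V]
    [FiniteDimensional ℂ V] (f : Module.End ℂ V) (hf : ∀ μ : ℂ, f.HasEigenvalue μ → 1 ≤ ‖μ‖)
    (v : V) (hv : Tendsto (fun t : ℕ => (f ^ t) v) atTop (𝓝 0)) : v = 0 := by
  let S : Submodule ℂ V :=
    { carrier := {v | Tendsto (fun t : ℕ => (f ^ t) v) atTop (𝓝 0)}
      add_mem' := fun {a b} ha hb => by simpa using Tendsto.add ha hb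
      zero_mem' := by simp
      smul_mem' := fun c x hx => by simpa using Tendsto.const_smul hx c }
  have hS : ∀ x ∈ S, f x ∈ S := fun x hx => by
    have := (tendsto_add_atTop_iff_nat 1).2 hx
    simpa [S, pow_succ] using this
  by_contra hne
  have : Nontrivial S := ⟨⟨v, hv⟩, 0, fun h => hne (congrArg Subtype.val h)⟩
  obtain ⟨μ, hμ⟩ := Module.End.exists_eigenvalue (f.restrict hS)
  obtain ⟨w, hw⟩ := hμ.exists_hasEigenvector
  have hw0 : (w : V) ≠ 0 := fun h => hw.2 (Subtype.ext h)
  have hfw : f.HasEigenvector μ w :=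
    Module.End.hasEigenvector_iff.2 ⟨Module.End.mem_eigenspace_iff.2
      (by simpa using congrArg Subtype.val hw.apply_eq_smul), hw0⟩
  have h1 := hf μ (Module.End.hasEigenvalue_of_hasEigenvector hfw)
  have h2 : Tendsto (fun t : ℕ => ‖(f ^ t) (w : V)‖) atTop (𝓝 0) := by
    simpa using (show Tendsto (fun t : ℕ => (f ^ t) (w : V)) atTop (𝓝 0) from w.2).norm
  have h3 : ‖(w : V)‖ ≤ 0 := by
    refine ge_of_tendsto' h2 fun t => ?_
    rw [hfw.pow_apply, norm_smul, norm_pow]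
    exact le_mul_of_one_le_left (norm_nonneg _) (one_le_pow₀ h1)
  exact hw0 (norm_le_zero_iff.1 h3)

/-- Gelfand's formula bounds the powers eventually by a geometric sequence. -/
theorem Matrix.tendsto_pow_zero_of_spectrum {n : ℕ} (A : Matrix (Fin n) (Fin n) ℂ)
    (hA : ∀ μ ∈ spectrum ℂ A, ‖μ‖ < 1) : Tendsto (fun t : ℕ => A ^ t) atTop (𝓝 0) := by
  let _ : NormedRing (Matrix (Fin n) (Fin n) ℂ) := Matrix.linftyOpNormedRing
  let _ : NormedAlgebra ℂ (Matrix (Fin n) (Fin n) ℂ) := Matrix.linftyOpNormedAlgebra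
  rcases Nat.eq_zero_or_pos n with rfl | hn
  · have : (fun t : ℕ => A ^ t) = fun _ => 0 := funext fun t => Subsingleton.elim _ _
    rw [this]; exact tendsto_const_nhds
  have : Nonempty (Fin n) := ⟨⟨0, hn⟩⟩
  have h1 : spectralRadius ℂ A < (1 : NNReal) :=
    spectrum.spectralRadius_lt_of_forall_lt A fun k hk => hA k hk
  obtain ⟨r, hr, hr1⟩ := ENNReal.lt_iff_exists_nnreal_btwn.1 h1
  have hr1' : r < 1 := by exact_mod_cast hr1
  have h2 := (spectrum.pow_nnnorm_pow_one_div_tendsto_nhds_spectralRadius A).eventually_lt_const hr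
  refine squeeze_zero_norm' (a := fun t : ℕ => (r : ℝ) ^ t) ?_
    (tendsto_pow_atTop_nhds_zero_of_lt_one r.2 hr1')
  filter_upwards [h2, eventually_gt_atTop 0] with t ht ht0
  have h3 : (‖A ^ t‖₊ : ENNReal) ≤ (r : ENNReal) ^ t := by
    have := ENNReal.rpow_le_rpow ht.le (Nat.cast_nonneg t : (0 : ℝ) ≤ t)
    rwa [← ENNReal.rpow_mul, one_div, inv_mul_cancel₀ (by positivity), ENNReal.rpow_one,
      ENNReal.rpow_natCast] at this
  exact_mod_cast h3

/-- Fredholm alternative: a column of `H` outside the range of `G` is separated from it by a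
functional, that is, by a vector `y`. -/
theorem Matrix.exists_mul_eq_of_vecMul_eq_zero {K α τ γ : Type*} [Field K] [Fintype α] [Fintype τ]
    [DecidableEq α] [DecidableEq τ] (G : Matrix α τ K) (H : Matrix α γ K)
    (h : ∀ y : α → K, y ᵥ* G = 0 → y ᵥ* H = 0) : ∃ R : Matrix τ γ K, G * R = H := by
  have key : ∀ j, H.col j ∈ LinearMap.range G.mulVecLin := fun j => by
    by_contra hj
    obtain ⟨f, hf, hle⟩ := Submodule.exists_le_ker_of_notMem hj
    obtain ⟨y, rfl⟩ := (dotProductEquiv K α).surjective f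
    refine hf ?_
    have hy : y ᵥ* G = 0 := by
      funext k
      have := hle ⟨Pi.single k 1, rfl⟩
      rw [← dotProduct_single_one (y ᵥ* G) k, ← dotProduct_mulVec]
      exact this
    exact congrFun (h y hy) j
  choose r hr using key
  refine ⟨Matrix.of fun k j => r j k, ?_⟩
  ext i j
  exact congrFun (hr j) i

namespace RegulatorDesign

/-! ### Stable and anti-stable matrices, Sylvester equations -/

theorem IsStable.tendsto_pow_mulVec {n : ℕ} {A : Matrix (Fin n) (Fin n) ℝ} (hA : IsStable A)
    (v : Fin n → ℝ) : Tendsto (fun t : ℕ => (A ^ t) *ᵥ v) atTop (𝓝 0) := by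
  have h := Matrix.tendsto_pow_zero_of_spectrum (A.map (algebraMap ℝ ℂ)) fun μ hμ =>
    hA μ (Module.End.hasEigenvalue_iff_mem_spectrum.2 (by rwa [Matrix.spectrum_toLin']))
  have hre : Continuous fun M : Matrix (Fin n) (Fin n) ℂ => M.map Complex.re :=
    continuous_id.matrix_map Complex.continuous_re
  have h2 : Tendsto (fun t : ℕ => A ^ t) atTop (𝓝 0) := by
    have := (hre.tendsto 0).comp h
    rw [show (0 : Matrix (Fin n) (Fin n) ℂ).map Complex.re = 0 by ext; simp] at this
    refine this.congr fun t => ?_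
    ext i j
    change ((A.map (algebraMap ℝ ℂ) ^ t).map Complex.re) i j = _
    rw [← Matrix.map_pow]
    simp
  have h3 : Continuous fun M : Matrix (Fin n) (Fin n) ℝ => M *ᵥ v := by fun_prop
  have := (h3.tendsto 0).comp h2
  rwa [Matrix.zero_mulVec] at this

theorem IsStable.trace_le {n : ℕ} {A : Matrix (Fin n) (Fin n) ℝ} (hA : IsStable A) :
    A.trace ≤ n := by
  have h1 : (A.trace : ℂ) = (A.map (algebraMap ℝ ℂ)).charpoly.roots.sum := by
    rw [← Matrix.trace_eq_sum_roots_charpoly]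
    simp [Matrix.trace]
  have h2 : ‖(A.map (algebraMap ℝ ℂ)).charpoly.roots.sum‖ ≤ n := by
    refine (norm_multiset_sum_le _).trans ?_
    refine (Multiset.sum_le_card_nsmul _ 1 ?_).trans ?_
    · intro x hx
      obtain ⟨μ, hμ, rfl⟩ := Multiset.mem_map.1 hx
      refine (hA μ (Module.End.hasEigenvalue_iff_mem_spectrum.2 ?_)).le
      rw [Matrix.spectrum_toLin']
      exact Matrix.mem_spectrum_of_isRoot_charpoly (Polynomial.isRoot_of_mem_roots hμ)
    · rw [Multiset.card_map, nsmul_one]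
      exact_mod_cast (Polynomial.card_roots' _).trans
        (by rw [Matrix.charpoly_natDegree_eq_dim, Fintype.card_fin])
  calc A.trace ≤ |A.trace| := le_abs_self _
    _ = ‖(A.trace : ℂ)‖ := by simp
    _ ≤ n := by rwa [h1]

theorem IsAntiStable.eq_zero_of_tendsto {n p : ℕ} {A : Matrix (Fin n) (Fin n) ℝ}
    (hA : IsAntiStable A) (C : Matrix (Fin p) (Fin n) ℝ)
    (hC : ∀ x, Tendsto (fun t : ℕ => C *ᵥ ((A ^ t) *ᵥ x)) atTop (𝓝 0)) : C = 0 := by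
  set B := A.map (algebraMap ℝ ℂ) with hB
  -- The rows of `C` have decaying orbits under the transpose, which has the same characteristic
  -- polynomial.
  have hev : ∀ μ : ℂ, Module.End.HasEigenvalue (Matrix.toLin' Bᵀ) μ → 1 ≤ ‖μ‖ := fun μ hμ => by
    refine hA μ ?_
    rw [Module.End.hasEigenvalue_iff_mem_spectrum, Matrix.spectrum_toLin',
      Matrix.mem_spectrum_iff_isRoot_charpoly] at hμ ⊢
    rwa [Matrix.charpoly_transpose] at hμ
  ext i j
  have h0 := Module.End.eq_zero_of_tendsto_pow (Matrix.toLin' Bᵀ) hev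
    (fun k => algebraMap ℝ ℂ (C i k)) ?_
  · simpa using congrFun h0 j
  rw [tendsto_pi_nhds]
  intro k
  have h1 := (tendsto_pi_nhds.1 (hC (Pi.single k 1))) i
  have h2 := (Complex.continuous_ofReal.tendsto _).comp h1
  refine (by simpa using h2 : Tendsto _ _ (𝓝 (0 : ℂ))).congr fun t => ?_
  rw [← Matrix.toLin'_pow, Matrix.toLin'_apply, ← Matrix.transpose_pow, hB, ← Matrix.map_pow,
    Matrix.mulVec_transpose]
  simp [Matrix.vecMul, Matrix.mulVec, dotProduct]

theorem eq_zero_of_intertwines {n₁ n₂ : ℕ} {A : Matrix (Fin n₁) (Fin n₁) ℝ}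
    {F : Matrix (Fin n₂) (Fin n₂) ℝ} (hA : IsAntiStable A) (hF : IsStable F)
    {P : Matrix (Fin n₂) (Fin n₁) ℝ} (hP : P * A = F * P) : P = 0 := by
  have hpow : ∀ t : ℕ, P * A ^ t = F ^ t * P := fun t => by
    induction t with
    | zero => simp
    | succ t ih =>
      rw [pow_succ, ← Matrix.mul_assoc, ih, Matrix.mul_assoc, hP, pow_succ, Matrix.mul_assoc]
  refine hA.eq_zero_of_tendsto P fun x => ?_
  refine (hF.tendsto_pow_mulVec (P *ᵥ x)).congr fun t => ?_
  rw [mulVec_mulVec, mulVec_mulVec, hpow]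

/-- The Sylvester operator is injective because `P * A = F * P` gives `P * A ^ t = F ^ t * P → 0`;
finite dimension makes it surjective. -/
theorem exists_sylvester_solution {n₁ n₂ : ℕ} {A : Matrix (Fin n₁) (Fin n₁) ℝ}
    {F : Matrix (Fin n₂) (Fin n₂) ℝ} (hA : IsAntiStable A) (hF : IsStable F)
    (Q : Matrix (Fin n₂) (Fin n₁) ℝ) : ∃ P : Matrix (Fin n₂) (Fin n₁) ℝ, P * A - F * P = Q := by
  let φ : Matrix (Fin n₂) (Fin n₁) ℝ →ₗ[ℝ] Matrix (Fin n₂) (Fin n₁) ℝ :=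
    { toFun := fun P => P * A - F * P
      map_add' := fun P P' => by rw [Matrix.add_mul, Matrix.mul_add]; abel
      map_smul' := fun c P => by simp [smul_sub] }
  have hinj : Function.Injective φ := by
    rw [← LinearMap.ker_eq_bot, LinearMap.ker_eq_bot']
    exact fun P hP => eq_zero_of_intertwines hA hF (sub_eq_zero.1 hP)
  exact LinearMap.injective_iff_surjective.1 hinj Q

/-! ### Regulation of a known system -/

variable {n₁ n₂ m p T : ℕ}
    {A₁ : Matrix (Fin n₁) (Fin n₁) ℝ} {A₂ : Matrix (Fin n₂) (Fin n₂) ℝ}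
    {B₂ : Matrix (Fin n₂) (Fin m) ℝ} {A₃ : Matrix (Fin n₂) (Fin n₁) ℝ}
    {D₁ : Matrix (Fin p) (Fin n₁) ℝ} {D₂ : Matrix (Fin p) (Fin n₂) ℝ}
    {E : Matrix (Fin p) (Fin m) ℝ} {K₁ : Matrix (Fin m) (Fin n₁) ℝ}
    {K₂ : Matrix (Fin m) (Fin n₂) ℝ} {P : Matrix (Fin n₂) (Fin n₁) ℝ}

/-- The subspace `x₂ = P x₁` is invariant. On it the output is a fixed matrix applied to `A₁ ^ t x`,
and anti-stability allows decay only if that matrix vanishes. -/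
theorem IsOutputRegulated.output_eq_zero (hA₁ : IsAntiStable A₁)
    (h : IsOutputRegulated A₁ A₂ B₂ A₃ D₁ D₂ E K₁ K₂)
    (hP : P * A₁ = A₂ * P + B₂ * (K₁ + K₂ * P) + A₃) :
    D₁ + D₂ * P + E * (K₁ + K₂ * P) = 0 := by
  refine hA₁.eq_zero_of_tendsto _ fun x => ?_
  have ht := h (fun t => A₁ ^ t *ᵥ x) (fun t => P *ᵥ (A₁ ^ t *ᵥ x))
    (fun t => K₁ *ᵥ (A₁ ^ t *ᵥ x) + K₂ *ᵥ (P *ᵥ (A₁ ^ t *ᵥ x)))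
    { exo := fun t => by rw [mulVec_mulVec, pow_succ']
      endo := fun t => by
        have := congrArg (fun M => M *ᵥ (A₁ ^ t *ᵥ x)) hP
        simp only [add_mulVec, ← mulVec_mulVec, mulVec_add] at this ⊢
        rw [pow_succ', ← mulVec_mulVec, this]
      feedback := fun t => rfl }
  refine ht.congr fun t => ?_
  simp only [add_mulVec, ← mulVec_mulVec, mulVec_add]

/-- The error `x₂ - P x₁` evolves autonomously under the stable closed loop, and the output depends
on this error alone. -/
theorem isRegulator_of_regulator_equations (hF : IsStable (A₂ + B₂ * K₂))
    (hP : P * A₁ = A₂ * P + B₂ * (K₁ + K₂ * P) + A₃)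
    (hD : D₁ + D₂ * P + E * (K₁ + K₂ * P) = 0) :
    IsRegulator A₁ A₂ B₂ A₃ D₁ D₂ E K₁ K₂ := by
  refine ⟨fun x₁ x₂ u h => ?_, hF⟩
  have herr : ∀ t, x₂ t - P *ᵥ x₁ t = (A₂ + B₂ * K₂) ^ t *ᵥ (x₂ 0 - P *ᵥ x₁ 0) := fun t => by
    induction t with
    | zero => simp
    | succ t ih =>
      have := congrArg (fun M => M *ᵥ x₁ t) hP
      rw [pow_succ', ← mulVec_mulVec, ← ih, h.endo, h.exo, h.feedback]
      simp only [add_mulVec, ← mulVec_mulVec, mulVec_add, mulVec_sub] at this ⊢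
      rw [this]
      abel
  have hz : ∀ t, D₁ *ᵥ x₁ t + D₂ *ᵥ x₂ t + E *ᵥ u t =
      (D₂ + E * K₂) *ᵥ ((A₂ + B₂ * K₂) ^ t *ᵥ (x₂ 0 - P *ᵥ x₁ 0)) := fun t => by
    have := congrArg (fun M => M *ᵥ x₁ t) hD
    rw [← herr, h.feedback]
    simp only [add_mulVec, ← mulVec_mulVec, mulVec_add, mulVec_sub, zero_mulVec] at this ⊢
    rw [← sub_eq_zero, ← this]
    abel
  have hc : Continuous fun v => (D₂ + E * K₂) *ᵥ v := by fun_prop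
  have := (hc.tendsto 0).comp (hF.tendsto_pow_mulVec (x₂ 0 - P *ᵥ x₁ 0))
  rw [mulVec_zero] at this
  exact this.congr fun t => (hz t).symm

theorem isRegulator_of_output_eq_zero (hF : IsStable (A₂ + B₂ * K₂))
    (h₁ : D₁ + E * K₁ = 0) (h₂ : D₂ + E * K₂ = 0) :
    IsRegulator A₁ A₂ B₂ A₃ D₁ D₂ E K₁ K₂ := by
  refine ⟨fun x₁ x₂ u h => tendsto_const_nhds.congr fun t => ?_, hF⟩
  have e₁ := congrArg (fun M => M *ᵥ x₁ t) h₁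
  have e₂ := congrArg (fun M => M *ᵥ x₂ t) h₂
  rw [h.feedback]
  simp only [add_mulVec, ← mulVec_mulVec, mulVec_add, zero_mulVec] at e₁ e₂ ⊢
  rw [← add_zero (0 : Fin p → ℝ), ← congrArg₂ (· + ·) e₁ e₂]
  abel

/-! ### Perturbations consistent with the data, and sufficiency -/

theorem eq_zero_of_forall_isStable {n : ℕ} {F : Matrix (Fin n) (Fin n) ℝ} {d : Fin n → ℝ}
    (h : ∀ c : ℝ, IsStable (F + c • vecMulVec d d)) : d = 0 := by
  by_contra hd
  have hpos : 0 < d ⬝ᵥ d := lt_of_le_of_ne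
    (Finset.sum_nonneg fun i _ => mul_self_nonneg _)
    fun h0 => hd (dotProduct_self_eq_zero.1 h0.symm)
  -- This `c` makes the trace of the perturbed matrix `n + 1`, beyond the bound `n` for stable
  -- matrices.
  have := (h ((n + 1 - F.trace) / (d ⬝ᵥ d))).trace_le
  rw [trace_add, trace_smul, trace_vecMulVec, smul_eq_mul, div_mul_cancel₀ _ hpos.ne'] at this
  linarith

variable {U : Matrix (Fin m) (Fin T) ℝ} {X₁ : Matrix (Fin n₁) (Fin T) ℝ}
    {X₂ : Matrix (Fin n₂) (Fin (T + 1)) ℝ}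

theorem add_mem_consistentSystems {A₀ : Matrix (Fin n₂) (Fin n₂) ℝ}
    {B₀ : Matrix (Fin n₂) (Fin m) ℝ} (h : (A₂, B₂) ∈ consistentSystems A₃ U X₁ X₂)
    (h₀ : A₀ * pastCols X₂ + B₀ * U = 0) :
    (A₂ + A₀, B₂ + B₀) ∈ consistentSystems A₃ U X₁ X₂ := by
  have h' : futureCols X₂ = A₂ * pastCols X₂ + A₃ * X₁ + B₂ * U := h
  change futureCols X₂ = (A₂ + A₀) * pastCols X₂ + A₃ * X₁ + (B₂ + B₀) * U
  rw [h', ← sub_eq_zero, ← neg_eq_zero, ← h₀]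
  simp only [Matrix.add_mul]
  abel

/-- If `(a, b)` annihilates the stacked data, put `d = a + b ᵥ* K₂`. Perturbing the system by `c d
aᵀ` and `c d bᵀ` changes the closed loop by `c d dᵀ`; stability for all `c` forces `d = 0`, which is
the Fredholm condition for `R`. -/
theorem exists_rightInverse_of_isStable (h : (A₂, B₂) ∈ consistentSystems A₃ U X₁ X₂)
    (hK : ∀ A B, (A, B) ∈ consistentSystems A₃ U X₁ X₂ → IsStable (A + B * K₂)) :
    ∃ R : Matrix (Fin T) (Fin n₂) ℝ, pastCols X₂ * R = 1 ∧ U * R = K₂ := by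
  obtain ⟨R, hR⟩ := Matrix.exists_mul_eq_of_vecMul_eq_zero
    (fromRows (pastCols X₂) U) (fromRows 1 K₂) fun y hy => by
      obtain ⟨⟨a, b⟩, rfl⟩ := (Equiv.sumArrowEquivProdArrow _ _ ℝ).symm.surjective y
      change Sum.elim a b ᵥ* _ = 0 at hy
      change Sum.elim a b ᵥ* _ = 0
      rw [sumElim_vecMul_fromRows] at hy ⊢
      rw [vecMul_one]
      refine eq_zero_of_forall_isStable (F := A₂ + B₂ * K₂) fun c => ?_
      have h₁ := hK _ _ (add_mem_consistentSystems
        (A₀ := c • vecMulVec (a + b ᵥ* K₂) a) (B₀ := c • vecMulVec (a + b ᵥ* K₂) b) h (by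
          rw [Matrix.smul_mul, Matrix.smul_mul, vecMulVec_mul, vecMulVec_mul, ← smul_add,
            ← vecMulVec_add, hy, show vecMulVec (a + b ᵥ* K₂) (0 : Fin T → ℝ) = 0 by
              ext; simp [vecMulVec], smul_zero]))
      convert h₁ using 1
      rw [vecMulVec_add, Matrix.add_mul, Matrix.smul_mul, vecMulVec_mul, smul_add]
      abel
  rw [fromRows_mul, fromRows_inj.eq_iff] at hR
  exact ⟨R, hR⟩

/-- The left side does not mention the system: with `W` a right inverse, all consistent systems
share one closed loop. -/
theorem data_mul_eq (h : (A₂, B₂) ∈ consistentSystems A₃ U X₁ X₂)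
    {γ : Type*} (W : Matrix (Fin T) γ ℝ) :
    (futureCols X₂ - A₃ * X₁) * W = A₂ * (pastCols X₂ * W) + B₂ * (U * W) := by
  have h' : futureCols X₂ = A₂ * pastCols X₂ + A₃ * X₁ + B₂ * U := h
  rw [h', ← Matrix.mul_assoc, ← Matrix.mul_assoc, ← Matrix.add_mul]
  congr 1
  abel

theorem rank_eq_of_rightInverse {R : Matrix (Fin T) (Fin n₂) ℝ} (h : pastCols X₂ * R = 1) :
    (pastCols X₂).rank = n₂ := by
  refine le_antisymm (by simpa using (pastCols X₂).rank_le_height) ?_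
  have := rank_mul_le_left (pastCols X₂) R
  rwa [h, rank_one, Fintype.card_fin] at this

theorem isRegulatorForData_of_output_eq_zero {R : Matrix (Fin T) (Fin n₂) ℝ}
    (hR : IsStabilizingRightInverse A₃ X₁ X₂ R) (h₂ : D₂ + E * U * R = 0)
    (h₁ : D₁ + E * K₁ = 0) : IsRegulatorForData A₁ A₃ D₁ D₂ E U X₁ X₂ K₁ (U * R) := by
  intro A₂ B₂ hS
  refine isRegulator_of_output_eq_zero ?_ h₁ (by rwa [← Matrix.mul_assoc])
  have := hR.2
  rwa [data_mul_eq hS, hR.1, Matrix.mul_one] at this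

theorem isRegulatorForData_of_solvesRegulatorEquations {R : Matrix (Fin T) (Fin n₂) ℝ}
    {W : Matrix (Fin T) (Fin n₁) ℝ} (hR : IsStabilizingRightInverse A₃ X₁ X₂ R)
    (hW : SolvesRegulatorEquations A₁ A₃ D₁ D₂ E U X₁ X₂ W) :
    IsRegulatorForData A₁ A₃ D₁ D₂ E U X₁ X₂ (U * (1 - R * pastCols X₂) * W) (U * R) := by
  intro A₂ B₂ hS
  have hu : U * (1 - R * pastCols X₂) * W + U * R * (pastCols X₂ * W) = U * W := by
    simp only [Matrix.mul_sub, Matrix.sub_mul, Matrix.mul_one, Matrix.mul_assoc, sub_add_cancel]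
  refine isRegulator_of_regulator_equations (P := pastCols X₂ * W) ?_ ?_ ?_
  · have := hR.2
    rwa [data_mul_eq hS, hR.1, Matrix.mul_one] at this
  · rw [hu, ← data_mul_eq hS]
    exact sub_eq_iff_eq_add'.1 hW.1
  · rw [hu, ← hW.2]
    simp only [Matrix.add_mul, Matrix.mul_assoc, add_assoc]

/-! ### Image inclusion and necessity of the conditions -/

theorem exists_add_mul_eq_zero
    (h : LinearMap.range D₁.mulVecLin ≤ LinearMap.range E.mulVecLin) :
    ∃ K₁ : Matrix (Fin m) (Fin n₁) ℝ, D₁ + E * K₁ = 0 := by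
  have key : ∀ j, D₁.col j ∈ LinearMap.range E.mulVecLin := fun j =>
    h ⟨Pi.single j 1, by simp⟩
  choose k hk using key
  refine ⟨-Matrix.of fun i j => k j i, ?_⟩
  rw [Matrix.mul_neg, ← sub_eq_add_neg, sub_eq_zero]
  ext i j
  exact (congrFun (hk j) i).symm

theorem range_le_of_add_mul_eq_zero (h : D₁ + E * K₁ = 0) :
    LinearMap.range D₁.mulVecLin ≤ LinearMap.range E.mulVecLin := by
  rw [eq_neg_of_add_eq_zero_left h, ← Matrix.mul_neg, Matrix.mulVecLin_mul]
  exact LinearMap.range_comp_le_range _ _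

/-- If the observed matrix `L` annihilates every solution `P` of a Sylvester equation whose
right-hand side is a left multiple of `N`, then `L = 0` or `N = 0`. -/
theorem eq_zero_of_sylvester_annihilated {k : ℕ} {F : Matrix (Fin n₂) (Fin n₂) ℝ}
    {L : Matrix (Fin p) (Fin n₂) ℝ} {N : Matrix (Fin k) (Fin n₁) ℝ} (hA : IsAntiStable A₁)
    (hF : IsStable F)
    (h : ∀ (M : Matrix (Fin n₂) (Fin k) ℝ) (P : Matrix (Fin n₂) (Fin n₁) ℝ), P * A₁ - F * P = M * N → L * P = 0)
    (hN : N ≠ 0) : L = 0 := by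
  have hLMN : ∀ M : Matrix (Fin n₂) (Fin k) ℝ, L * (M * N) = 0 := fun M => by
    obtain ⟨P, hP⟩ := exists_sylvester_solution hA hF (M * N)
    have h₁ := h M P hP
    -- If `P` solves the equation for `M`, then `F * P` solves it for `F * M`, so `L` kills both
    -- terms of `P * A₁ - F * P`.
    have h₂ := h (F * M) (F * P) (by
      rw [Matrix.mul_assoc, ← Matrix.mul_sub, hP, Matrix.mul_assoc])
    rw [← hP, Matrix.mul_sub, ← Matrix.mul_assoc, h₁, h₂, Matrix.zero_mul, sub_zero]
  obtain ⟨i, j, hij⟩ : ∃ i j, N i j ≠ 0 := by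
    by_contra! h0
    exact hN (by ext i j; exact h0 i j)
  ext a b
  have := congrFun (congrFun (hLMN (Matrix.single b i 1)) a) j
  rw [← Matrix.mul_assoc, Matrix.mul_apply, Finset.sum_eq_single i] at this
  · simpa [hij] using this
  · intro i' _ hi'
    simp [Matrix.mul_single_apply_of_ne, hi']
  · simp

theorem IsRegulatorForData.necessary (hA₁ : IsAntiStable A₁)
    (hS : (A₂, B₂) ∈ consistentSystems A₃ U X₁ X₂)
    (h : IsRegulatorForData A₁ A₃ D₁ D₂ E U X₁ X₂ K₁ K₂) :
    ∃ R, IsStabilizingRightInverse A₃ X₁ X₂ R ∧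
      ((D₂ + E * U * R = 0 ∧ LinearMap.range D₁.mulVecLin ≤ LinearMap.range E.mulVecLin) ∨
        ∃ W, SolvesRegulatorEquations A₁ A₃ D₁ D₂ E U X₁ X₂ W) := by
  obtain ⟨R, hXR, rfl⟩ := exists_rightInverse_of_isStable hS fun A B hAB => (h A B hAB).2
  have hF := (h _ _ hS).2
  refine ⟨R, ⟨hXR, by rwa [data_mul_eq hS, hXR, Matrix.mul_one]⟩, ?_⟩
  obtain ⟨P, hP⟩ := exists_sylvester_solution hA₁ hF (A₃ + B₂ * K₁)
  have hP' : P * A₁ = A₂ * P + B₂ * (K₁ + U * R * P) + A₃ := by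
    rw [sub_eq_iff_eq_add.1 hP]
    simp only [Matrix.add_mul, Matrix.mul_add, Matrix.mul_assoc]
    abel
  have hD := (h _ _ hS).1.output_eq_zero hA₁ hP'
  by_cases hL : D₂ + E * (U * R) = 0
  · refine Or.inl ⟨by rwa [Matrix.mul_assoc], range_le_of_add_mul_eq_zero (K₁ := K₁) ?_⟩
    have : D₁ + D₂ * P + E * (K₁ + U * R * P) = D₁ + E * K₁ + (D₂ + E * (U * R)) * P := by
      simp only [Matrix.add_mul, Matrix.mul_add, Matrix.mul_assoc]
      abel
    rwa [this, hL, Matrix.zero_mul, add_zero] at hD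
  right
  -- Since `L ≠ 0`, a `b` annihilating this matrix must annihilate `K₁`. Otherwise `(-(M * β * U *
  -- R), M * β)` preserves the data and the closed loop but shifts `P` by a solution `Q` with
  -- right-hand side `M * β * K₁`; zero output before and after gives `L * Q = 0` for every `M`.
  obtain ⟨V, hV⟩ := Matrix.exists_mul_eq_of_vecMul_eq_zero (U - U * R * pastCols X₂) K₁
    fun b hb => by
      by_contra hne
      let β : Matrix (Fin 1) (Fin m) ℝ := Matrix.of fun _ => b
      have hβ : β * (U - U * R * pastCols X₂) = 0 := by
        ext i j; exact congrFun hb j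
      have hN : β * K₁ ≠ 0 := fun h0 => hne (congrFun h0 0)
      refine hL (eq_zero_of_sylvester_annihilated hA₁ hF (N := β * K₁) (fun M Q hQ => ?_) hN)
      have hmem := add_mem_consistentSystems (A₀ := -(M * β * (U * R))) (B₀ := M * β) hS (by
        rw [Matrix.mul_sub, sub_eq_zero] at hβ
        rw [Matrix.mul_assoc M β U, hβ]
        simp only [Matrix.neg_mul, Matrix.mul_assoc, neg_add_cancel])
      have hPQ := (h _ _ hmem).1.output_eq_zero hA₁ (P := P + Q) (by
        rw [Matrix.add_mul, hP', sub_eq_iff_eq_add.1 hQ]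
        simp only [Matrix.add_mul, Matrix.mul_add, Matrix.mul_assoc, Matrix.neg_mul]
        abel)
      have hLQ : (D₂ + E * (U * R)) * Q = D₁ + D₂ * (P + Q) + E * (K₁ + U * R * (P + Q)) -
          (D₁ + D₂ * P + E * (K₁ + U * R * P)) := by
        simp only [Matrix.add_mul, Matrix.mul_add, Matrix.mul_assoc]
        abel
      rw [hLQ, hPQ, hD, sub_zero]
  -- The first term gives `pastCols X₂ * W = P`; the second is invisible to `pastCols X₂` and adds
  -- the missing `K₁` to `U * W`.
  refine ⟨R * P + (1 - R * pastCols X₂) * V, ?_⟩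
  have hX : pastCols X₂ * (R * P + (1 - R * pastCols X₂) * V) = P := by
    rw [Matrix.mul_add, ← Matrix.mul_assoc, ← Matrix.mul_assoc, Matrix.mul_sub,
      ← Matrix.mul_assoc, hXR]
    simp
  have hU : U * (R * P + (1 - R * pastCols X₂) * V) = K₁ + U * R * P := by
    rw [← hV]
    simp only [Matrix.mul_add, Matrix.sub_mul, Matrix.mul_sub, Matrix.one_mul, Matrix.mul_assoc]
    abel
  refine ⟨?_, ?_⟩
  · rw [data_mul_eq hS, hX, hU, hP', add_sub_cancel_left]
  · rw [Matrix.add_mul, Matrix.mul_assoc, Matrix.mul_assoc, hX, hU, ← add_assoc, hD]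

end RegulatorDesign

theorem mainTheorem8 {n₁ n₂ m p T : ℕ}
    (A₁ : Matrix (Fin n₁) (Fin n₁) ℝ) (A₃ : Matrix (Fin n₂) (Fin n₁) ℝ)
    (D₁ : Matrix (Fin p) (Fin n₁) ℝ) (D₂ : Matrix (Fin p) (Fin n₂) ℝ)
    (E : Matrix (Fin p) (Fin m) ℝ)
    (A₂s : Matrix (Fin n₂) (Fin n₂) ℝ) (B₂s : Matrix (Fin n₂) (Fin m) ℝ)
    (U : Matrix (Fin m) (Fin T) ℝ) (X₁ : Matrix (Fin n₁) (Fin T) ℝ)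
    (X₂ : Matrix (Fin n₂) (Fin (T + 1)) ℝ)
    (hA₁ : IsAntiStable A₁)
    (htrue : (A₂s, B₂s) ∈ consistentSystems A₃ U X₁ X₂) :
    -- necessary and sufficient conditions
    (IsInformativeForRegulatorDesign A₁ A₃ D₁ D₂ E U X₁ X₂ ↔
      ((pastCols X₂).rank = n₂ ∧
        (∃ R : Matrix (Fin T) (Fin n₂) ℝ,
          IsStabilizingRightInverse A₃ X₁ X₂ R ∧ D₂ + E * U * R = 0) ∧
        LinearMap.range D₁.mulVecLin ≤ LinearMap.range E.mulVecLin) ∨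
      ((pastCols X₂).rank = n₂ ∧
        (∃ R : Matrix (Fin T) (Fin n₂) ℝ, IsStabilizingRightInverse A₃ X₁ X₂ R) ∧
        (∃ W : Matrix (Fin T) (Fin n₁) ℝ,
          SolvesRegulatorEquations A₁ A₃ D₁ D₂ E U X₁ X₂ W))) ∧
    -- regulators under the first condition
    (∀ R : Matrix (Fin T) (Fin n₂) ℝ,
      (pastCols X₂).rank = n₂ → IsStabilizingRightInverse A₃ X₁ X₂ R → D₂ + E * U * R = 0 →
      LinearMap.range D₁.mulVecLin ≤ LinearMap.range E.mulVecLin →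
        (∃ K₁ : Matrix (Fin m) (Fin n₁) ℝ, D₁ + E * K₁ = 0) ∧
        ∀ K₁ : Matrix (Fin m) (Fin n₁) ℝ, D₁ + E * K₁ = 0 →
          IsRegulatorForData A₁ A₃ D₁ D₂ E U X₁ X₂ K₁ (U * R)) ∧
    -- regulators under the second condition
    (∀ (R : Matrix (Fin T) (Fin n₂) ℝ) (W : Matrix (Fin T) (Fin n₁) ℝ),
      (pastCols X₂).rank = n₂ → IsStabilizingRightInverse A₃ X₁ X₂ R →
      SolvesRegulatorEquations A₁ A₃ D₁ D₂ E U X₁ X₂ W →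
        IsRegulatorForData A₁ A₃ D₁ D₂ E U X₁ X₂ (U * (1 - R * pastCols X₂) * W) (U * R)) := by
  refine ⟨⟨?_, ?_⟩, ?_, ?_⟩
  · rintro ⟨K₁, K₂, h⟩
    obtain ⟨R, hR, hE | hW⟩ := h.necessary hA₁ htrue
    · exact Or.inl ⟨rank_eq_of_rightInverse hR.1, ⟨R, hR, hE.1⟩, hE.2⟩
    · exact Or.inr ⟨rank_eq_of_rightInverse hR.1, ⟨R, hR⟩, hW⟩
  · rintro (⟨-, ⟨R, hR, h₂⟩, h₁⟩ | ⟨-, ⟨R, hR⟩, ⟨W, hW⟩⟩)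
    · obtain ⟨K₁, hK₁⟩ := exists_add_mul_eq_zero h₁
      exact ⟨K₁, U * R, isRegulatorForData_of_output_eq_zero hR h₂ hK₁⟩
    · exact ⟨_, _, isRegulatorForData_of_solvesRegulatorEquations hR hW⟩
  · exact fun R _ hR h₂ h₁ => ⟨exists_add_mul_eq_zero h₁,
      fun K₁ hK₁ => isRegulatorForData_of_output_eq_zero hR h₂ hK₁⟩
  · exact fun R W _ hR hW => isRegulatorForData_of_solvesRegulatorEquations hR hW
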